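/- A complex unital Banach algebra is a complex Banach space $\mathcal A$ that is an algebra with unit $\mathbf 1$ such that $\|\mathbf 1\|=1$ and $\|ab\|\le\|a\|\|b\|$. An element $a\in\mathcal A$ is called Hermitian if its numerical range $V(a)=\{\varphi(a):\varphi\in\mathcal A^*,\ \varphi(\mathbf 1)=\|\varphi\|=1\}$ is contained in $\mathbb R$; then its spectrum $\sigma(a)$ is contained in $\mathbb R$. For a finite complex Borel measure $\mu$ on $\mathbb R$ put $\hat\mu(\xi)=\int_{\mathbb R}e^{i\xi x}\,d\mu(x)$. A symbol is a function $F:\mathbb R\to\mathbb C$ that coincides, in a neighbourhood of each point of $\mathbb R$, with $\hat\mu$ for some finite complex Borel measure $\mu$. If $F$ is a symbol and $a$ is Hermitian, put $F(a)=\int_{\mathbb R}\exp(ita)\,d\mu(t)$, where $\mu$ is any finite complex Borel measure with $\hat\mu=F$ in a real neighbourhood of $\sigma(a)$ (such $\mu$ exist, and $F(a)$ does not depend on the choice of $\mu$). A symbol $F$ is called universal if, for every complex unital Banach algebra $\mathcal A$ and every Hermitian $a\in\mathcal A$, the norm $\|F(a)\|$ equals the spectral radius of $F(a)$. **Theorem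 2.2.** Let $F$ be a universal symbol, and let $$m_F=\Bigl\{x\in\mathbb R:\ |F(x)|=\inf_{t\in\mathbb R}|F(t)|\Bigr\}.$$ Then $m_F$ is connected, where the empty set counts as connected ($m_F$ may be empty). The set $\mathbb R\setminus m_F$ has at most two connected components, and if $U$ is a connected component of $\mathbb R\setminus m_F$, then $|F|$ is strictly monotone and unbounded on $U$. -/

import Mathlib

open MeasureTheory Filter Topology

universe u

namespace UniversalSymbol

/-- The integral `∫ f dμ` of a function `f : ℝ → E` with values in a complex Banach space against a
finite complex Borel measure `μ` on `ℝ`. It is Mathlib's integral against a vector measure, for the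
pairing `(v, z) ↦ z • v` of `E` with `ℂ`. A complex measure has finite total variation, so every
bounded continuous function is integrable. -/
noncomputable def cintegral {E : Type u} [NormedAddCommGroup E] [NormedSpace ℂ E]
    (μ : ComplexMeasure ℝ) (f : ℝ → E) : E :=
  VectorMeasure.integral μ f
    (ContinuousLinearMap.lsmul ℝ ℂ : ℂ →L[ℝ] E →L[ℝ] E).flip

/-- The Fourier-Stieltjes transform `ξ ↦ ∫ exp(i ξ x) dμ(x)` of a finite complex Borel measure. -/
noncomputable def fourierStieltjes (μ : ComplexMeasure ℝ) (ξ : ℝ) : ℂ :=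
  cintegral μ fun x : ℝ => Complex.exp (Complex.I * (ξ * x : ℝ))

/-- `F` belongs locally to the Fourier-Stieltjes algebra `B(ℝ)`: near every point it coincides with
the transform of some finite complex Borel measure. -/
def IsSymbol (F : ℝ → ℂ) : Prop :=
  ∀ x : ℝ, ∃ μ : ComplexMeasure ℝ, ∀ᶠ y in 𝓝 x, F y = fourierStieltjes μ y

/-- The numerical range `{φ(a) : φ ∈ A*, φ(1) = ‖φ‖ = 1}` of an element of a Banach algebra. -/
def numericalRange {A : Type u} [NormedRing A] [NormedAlgebra ℂ A] (a : A) : Set ℂ :=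
  {z | ∃ φ : StrongDual ℂ A, φ 1 = 1 ∧ ‖φ‖ = 1 ∧ φ a = z}

/-- An element is Hermitian if its numerical range is real. -/
def IsHermitianElement {A : Type u} [NormedRing A] [NormedAlgebra ℂ A] (a : A) : Prop :=
  ∀ z ∈ numericalRange a, z.im = 0

/-- `∫ exp(i t a) dμ(t)`. -/
noncomputable def expIntegral {A : Type u} [NormedRing A] [NormedAlgebra ℂ A]
    (μ : ComplexMeasure ℝ) (a : A) : A :=
  cintegral μ fun t : ℝ => NormedSpace.exp ((Complex.I * (t : ℂ)) • a)

/-- `b = F(a)` in the functional calculus for Hermitian elements: `b = ∫ exp(i t a) dμ(t)` for a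
complex measure `μ` whose transform coincides with `F` in a real neighbourhood of the spectrum of
`a` (which is a subset of `ℝ` for Hermitian `a`). -/
def IsValueAt {A : Type u} [NormedRing A] [NormedAlgebra ℂ A]
    (F : ℝ → ℂ) (a b : A) : Prop :=
  ∃ μ : ComplexMeasure ℝ,
    (∀ᶠ x in 𝓝ˢ {x : ℝ | (x : ℂ) ∈ spectrum ℂ a}, F x = fourierStieltjes μ x) ∧
      expIntegral μ a = b

/-- A symbol `F` is universal if the norm of `F(a)` is its spectral radius, for every complex unital
Banach algebra `A` (with `‖1‖ = 1`) and every Hermitian `a` in `A`. -/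
structure IsUniversalSymbol (F : ℝ → ℂ) : Prop where
  isSymbol : IsSymbol F
  enorm_eq_spectralRadius : ∀ (A : Type u) [NormedRing A] [NormOneClass A] [NormedAlgebra ℂ A]
    [CompleteSpace A] (a : A), IsHermitianElement a →
      ∀ b : A, IsValueAt F a b → ‖b‖ₑ = spectralRadius ℂ b

/-- The set of points where `|F|` attains its infimum. -/
def minSet (F : ℝ → ℂ) : Set ℝ :=
  {x : ℝ | ‖F x‖ = ⨅ t : ℝ, ‖F t‖}

/-- The set of connected components of a subset `s` of the line. -/
def components (s : Set ℝ) : Set (Set ℝ) :=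
  {U | ∃ x ∈ s, U = connectedComponentIn s x}

end UniversalSymbol

/-! Universality is tested on one family of algebras. For a finite set `Λ` of frequencies, let `X`
be the span of the functions `exp(iλt)`, `λ ∈ Λ`, under the sup norm, and let `a` act by `λ` on the
`λ`-th exponential. Then `exp(ita)` is translation by `t`, so `a` is Hermitian, and `F(a)` is
diagonal with entries `F(λ)`. Its norm is therefore at most `max |F|` on `Λ`; evaluation at `0`
gives `|∑ F(λ) p_λ| ≤ max |F| · sup |∑ p_λ exp(iλt)|` (`IsUniversalSymbol.norm_sum_le`).

On a progression `x - d, x, x + d`, perturbing a single exponential at a point where `|F|` is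
largest gives first-order conditions (`re_sum_div_nonpos`). With `g = |F|`, two perturbations yield:
(A) if `g x` is largest, then `g (x + d) = g (x - d)` (`norm_symm`); (B) if `g (x - d)` is largest,
then `2 g(x)² - g(x - d)² ≤ g(x + d) g(x - d)` (`two_mul_sq_le`).

The rest is real analysis of a continuous `g ≥ 0`. From (A), `g` is quasiconvex
(`le_max_of_symmetric`) and, once it takes a smaller value further right, strictly decreasing to the
left of there. By (B) such a branch cannot level off at a finite supremum. The complement of the
minimum set is the union of a descending left branch and an ascending right branch. -/

namespace UniversalSymbol

/-! ### Reduction of complex measures to finite positive measures. -/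

section ComplexMeasure

/-- The complex measure `c • ν` for a finite measure `ν` and a complex number `c`. -/
noncomputable def weighted (c : ℂ) (ν : Measure ℝ) [IsFiniteMeasure ν] : ComplexMeasure ℝ :=
  ν.toSignedMeasure.mapRange (LinearMap.toSpanSingleton ℝ ℂ c).toAddMonoidHom
    (LinearMap.toSpanSingleton ℝ ℂ c).continuous_of_finiteDimensional

lemma weighted_apply (c : ℂ) (ν : Measure ℝ) [IsFiniteMeasure ν] {s : Set ℝ}
    (hs : MeasurableSet s) : weighted c ν s = ν.real s • c := by
  rw [← Measure.toSignedMeasure_apply_measurable hs]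
  rfl

lemma variation_weighted_le (c : ℂ) (ν : Measure ℝ) [IsFiniteMeasure ν] :
    (weighted c ν).variation ≤ ‖c‖ₑ • ν := by
  refine VectorMeasure.variation_le_of_forall_enorm_le fun s hs => ?_
  rw [weighted_apply c ν hs, enorm_smul, Measure.smul_apply, smul_eq_mul, mul_comm]
  gcongr
  rw [Real.enorm_eq_ofReal measureReal_nonneg, ofReal_measureReal]

lemma integrable_weighted {E : Type u} [NormedAddCommGroup E] (c : ℂ)
    (ν : Measure ℝ) [IsFiniteMeasure ν] {f : ℝ → E} (hf : Integrable f ν) :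
    (weighted c ν).Integrable f :=
  hf.of_measure_le_smul enorm_ne_top (variation_weighted_le c ν)

variable {E : Type u} [NormedAddCommGroup E] [NormedSpace ℂ E]

/-- Both sides agree on indicators, and both are continuous in `L¹(ν)` because the variation of
`weighted c ν` is dominated by `‖c‖ₑ • ν`; density does the rest. -/
lemma cintegral_weighted [CompleteSpace E] (c : ℂ) (ν : Measure ℝ) [IsFiniteMeasure ν]
    {f : ℝ → E} (hf : Integrable f ν) : cintegral (weighted c ν) f = c • ∫ x, f x ∂ν := by
  have hle := variation_weighted_le c ν
  have hint : ∀ {g : ℝ → E}, Integrable g ν → (weighted c ν).Integrable g :=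
    fun hg => integrable_weighted c ν hg
  refine Integrable.induction (P := fun f => cintegral (weighted c ν) f = c • ∫ x, f x ∂ν)
    ?_ ?_ ?_ ?_ hf
  · intro v s hs hsf
    unfold cintegral
    rw [VectorMeasure.integral_eq_setToFun, setToFun_indicator_const _ hs,
      integral_indicator_const _ hs]
    · change (weighted c ν s) • v = _
      rw [weighted_apply c ν hs, smul_assoc, smul_comm]
    · exact ne_top_of_le_ne_top (by simp [ENNReal.mul_eq_top]) (hle s)
  · intro f g _ hf hg ihf ihg
    unfold cintegral at *
    rw [VectorMeasure.integral_add (hint hf) (hint hg), ihf, ihg, integral_add' hf hg, smul_add]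
  · have h1 : Continuous fun f : ℝ →₁[ν] E => cintegral (weighted c ν) f := by
      refine continuous_iff_continuousAt.2 fun f => ?_
      refine VectorMeasure.tendsto_integral_of_L1 _ (hint (L1.integrable_coeFn f)).aestronglyMeasurable
        (.of_forall fun g => hint (L1.integrable_coeFn g)) ?_
      have h2 : Tendsto (fun g : ℝ →₁[ν] E => ‖c‖ₑ * ‖g - f‖ₑ) (𝓝 f) (𝓝 0) := by
        have : Tendsto (fun g : ℝ →₁[ν] E => ‖g - f‖ₑ) (𝓝 f) (𝓝 0) := by
          have : Continuous fun g : ℝ →₁[ν] E => ‖g - f‖ₑ := by fun_prop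
          simpa using this.tendsto f
        simpa using ENNReal.Tendsto.const_mul this (Or.inr enorm_ne_top)
      refine tendsto_of_tendsto_of_tendsto_of_le_of_le tendsto_const_nhds h2 (fun _ => zero_le)
        fun g => ?_
      refine (lintegral_mono' hle le_rfl).trans ?_
      rw [lintegral_smul_measure, smul_eq_mul]
      gcongr
      rw [Lp.enorm_def, eLpNorm_one_eq_lintegral_enorm]
      refine (lintegral_congr_ae ?_).le
      filter_upwards [Lp.coeFn_sub g f] with x hx
      exact congrArg _ hx.symm
    exact isClosed_eq h1 (continuous_integral.const_smul c)
  · intro f g hfg hf ih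
    rw [← integral_congr_ae hfg, ← ih]
    exact (VectorMeasure.integral_congr_ae
      ((Measure.absolutelyContinuous_of_le_smul hle) hfg)).symm

lemma cintegral_sum_weighted [CompleteSpace E] {ι : Type*} [Fintype ι] (c : ι → ℂ)
    (ν : ι → Measure ℝ) [∀ i, IsFiniteMeasure (ν i)] {f : ℝ → E}
    (hf : ∀ i, Integrable f (ν i)) :
    cintegral (∑ i, weighted (c i) (ν i)) f = ∑ i, c i • ∫ x, f x ∂(ν i) := by
  unfold cintegral
  rw [VectorMeasure.integral_finsetSum_vectorMeasure
    fun i _ => integrable_weighted (c i) (ν i) (hf i)]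
  exact Finset.sum_congr rfl fun i _ => cintegral_weighted (c i) (ν i) (hf i)

/-- Jordan decomposition of the real and imaginary parts. -/
lemma exists_eq_sum_weighted (μ : ComplexMeasure ℝ) :
    ∃ (c : Fin 4 → ℂ) (ν : Fin 4 → Measure ℝ) (_ : ∀ i, IsFiniteMeasure (ν i)),
      μ = ∑ i, weighted (c i) (ν i) := by
  let j := (ComplexMeasure.re μ).toJordanDecomposition
  let k := (ComplexMeasure.im μ).toJordanDecomposition
  have hfin : ∀ i, IsFiniteMeasure (![j.posPart, j.negPart, k.posPart, k.negPart] i) := by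
    intro i
    fin_cases i
    exacts [j.posPart_finite, j.negPart_finite, k.posPart_finite, k.negPart_finite]
  refine ⟨![1, -1, Complex.I, -Complex.I], _, hfin, ?_⟩
  have hj : ComplexMeasure.re μ = j.toSignedMeasure :=
    (SignedMeasure.toSignedMeasure_toJordanDecomposition _).symm
  have hk : ComplexMeasure.im μ = k.toSignedMeasure :=
    (SignedMeasure.toSignedMeasure_toJordanDecomposition _).symm
  ext s hs
  have hre : (μ s).re = j.posPart.real s - j.negPart.real s := by
    change ComplexMeasure.re μ s = _
    rw [hj, JordanDecomposition.toSignedMeasure, Measure.toSignedMeasure_sub_apply hs]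
  have him : (μ s).im = k.posPart.real s - k.negPart.real s := by
    change ComplexMeasure.im μ s = _
    rw [hk, JordanDecomposition.toSignedMeasure, Measure.toSignedMeasure_sub_apply hs]
  rw [FunLike.coe_sum, Finset.sum_apply,
    Finset.sum_congr rfl fun i _ => weighted_apply _ _ hs, Fin.sum_univ_four]
  apply Complex.ext <;> simp [hre, him] <;> ring

/-- Integration against a complex measure commutes with bounded linear maps. -/
lemma cintegral_comp_clm [CompleteSpace E] {G : Type*} [NormedAddCommGroup G] [NormedSpace ℂ G]
    [CompleteSpace G] (μ : ComplexMeasure ℝ) (L : E →L[ℂ] G) (f : BoundedContinuousFunction ℝ E) :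
    cintegral μ (fun x => L (f x)) = L (cintegral μ f) := by
  obtain ⟨c, ν, hν, rfl⟩ := exists_eq_sum_weighted μ
  have hf : ∀ i, Integrable f (ν i) := fun i => by
    refine Integrable.of_bound ?_ ‖f‖ (.of_forall f.norm_coe_le_norm)
    exact f.continuous.aestronglyMeasurable
  rw [cintegral_sum_weighted c ν hf, cintegral_sum_weighted c ν fun i => L.integrable_comp (hf i),
    map_sum]
  exact Finset.sum_congr rfl fun i _ => by rw [L.integral_comp_comm (hf i), map_smul]

end ComplexMeasure

/-! ### The Fourier-Stieltjes algebra and localisation of symbols. -/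

section Transform

/-- The Fourier-Stieltjes algebra `B(ℝ)`, spanned by the transforms of finite measures. -/
noncomputable def transforms : Submodule ℂ (ℝ → ℂ) :=
  Submodule.span ℂ {f | ∃ ν : Measure ℝ, IsFiniteMeasure ν ∧ charFun ν = f}

lemma charFun_mem_transforms (ν : Measure ℝ) [h : IsFiniteMeasure ν] : charFun ν ∈ transforms :=
  Submodule.subset_span ⟨ν, h, rfl⟩

lemma integrable_character (ν : Measure ℝ) [IsFiniteMeasure ν] (ξ : ℝ) :
    Integrable (fun x : ℝ => Complex.exp (Complex.I * (ξ * x : ℝ))) ν := by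
  refine Integrable.of_bound (by fun_prop) 1 (.of_forall fun x => ?_)
  rw [mul_comm, Complex.norm_exp_ofReal_mul_I]

lemma fourierStieltjes_sum_weighted {ι : Type*} [Fintype ι] (c : ι → ℂ)
    (ν : ι → Measure ℝ) [∀ i, IsFiniteMeasure (ν i)] :
    fourierStieltjes (∑ i, weighted (c i) (ν i)) = ∑ i, c i • charFun (ν i) := by
  ext ξ
  rw [fourierStieltjes, cintegral_sum_weighted c ν fun i => integrable_character (ν i) ξ,
    Finset.sum_apply]
  refine Finset.sum_congr rfl fun i _ => ?_
  rw [Pi.smul_apply, charFun_apply_real]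
  simp [mul_comm]

lemma fourierStieltjes_mem_transforms (μ : ComplexMeasure ℝ) :
    fourierStieltjes μ ∈ transforms := by
  obtain ⟨c, ν, hν, rfl⟩ := exists_eq_sum_weighted μ
  rw [fourierStieltjes_sum_weighted]
  exact Submodule.sum_mem _ fun i _ => Submodule.smul_mem _ _ (charFun_mem_transforms _)

lemma exists_fourierStieltjes_eq {f : ℝ → ℂ} (hf : f ∈ transforms) :
    ∃ μ : ComplexMeasure ℝ, fourierStieltjes μ = f := by
  obtain ⟨n, c, g, rfl⟩ := (Submodule.mem_span_set').1 hf
  choose ν hν hg using fun i => (g i).2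
  exact ⟨∑ i, weighted (c i) (ν i), by simp [fourierStieltjes_sum_weighted, hg]⟩

lemma mul_mem_transforms {f g : ℝ → ℂ} (hf : f ∈ transforms) (hg : g ∈ transforms) :
    f * g ∈ transforms := by
  have h := Submodule.mul_mem_mul hf hg
  rw [transforms, Submodule.span_mul_span] at h
  refine Submodule.span_mono ?_ h
  rintro _ ⟨_, ⟨ν, hν, rfl⟩, _, ⟨ν', hν', rfl⟩, rfl⟩
  exact ⟨ν.conv ν', inferInstance, funext fun t => charFun_conv t⟩

lemma continuous_of_mem_transforms {f : ℝ → ℂ} (hf : f ∈ transforms) : Continuous f := by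
  induction hf using Submodule.span_induction with
  | mem f hf =>
    obtain ⟨ν, hν, rfl⟩ := hf
    exact continuous_charFun
  | zero => exact continuous_zero
  | add f g _ _ hf hg => exact hf.add hg
  | smul c f _ hf => exact hf.const_smul c

/-- The measure is the push-forward of `g dx` under multiplication by `r`; the factor `r` is there
to absorb the `-2π` in the normalisation of `𝓕`. -/
lemma integral_nonneg_density_mem_transforms {g : ℝ → ℝ} (hg : Integrable g) (h0 : 0 ≤ g) (r : ℝ) :
    (fun ξ : ℝ => ∫ x, Complex.exp ((r * ξ * x : ℝ) * Complex.I) * (g x : ℂ)) ∈ transforms := by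
  have hfin : IsFiniteMeasure (volume.withDensity fun x => ENNReal.ofReal (g x)) :=
    isFiniteMeasure_withDensity_ofReal hg.2
  have hfin' := Measure.isFiniteMeasure_map (volume.withDensity fun x => ENNReal.ofReal (g x))
    (r * ·)
  convert charFun_mem_transforms
    (((volume : Measure ℝ).withDensity fun x => ENNReal.ofReal (g x)).map (r * ·)) using 1
  ext ξ
  rw [charFun_map_mul, charFun_apply_real, integral_withDensity_eq_integral_toReal_smul₀
    hg.1.aemeasurable.ennreal_ofReal (by simp)]
  refine integral_congr_ae (.of_forall fun x => ?_)
  simp [ENNReal.toReal_ofReal (h0 x), mul_comm]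

lemma integral_real_density_mem_transforms {g : ℝ → ℝ} (hg : Integrable g) (r : ℝ) :
    (fun ξ : ℝ => ∫ x, Complex.exp ((r * ξ * x : ℝ) * Complex.I) * (g x : ℂ)) ∈ transforms := by
  convert Submodule.sub_mem _
    (integral_nonneg_density_mem_transforms hg.pos_part (fun x => le_max_right _ _) r)
    (integral_nonneg_density_mem_transforms hg.neg_part (fun x => le_max_right _ _) r) using 1
  ext ξ
  have hb : ∀ {h : ℝ → ℝ}, Integrable h → Integrable fun x =>
      Complex.exp ((r * ξ * x : ℝ) * Complex.I) * (h x : ℂ) := fun hh =>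
    hh.ofReal.bdd_mul (c := 1) (by fun_prop)
      (.of_forall fun x => (Complex.norm_exp_ofReal_mul_I _).le)
  rw [Pi.sub_apply, ← integral_sub (hb hg.pos_part) (hb hg.neg_part)]
  refine integral_congr_ae (.of_forall fun x => ?_)
  simp only [← mul_sub, ← Complex.ofReal_sub]
  congr 2
  rcases le_total 0 (g x) with h | h <;> simp [h]

open scoped FourierTransform in
lemma schwartz_mem_transforms (f : SchwartzMap ℝ ℂ) : (f : ℝ → ℂ) ∈ transforms := by
  obtain ⟨g, rfl⟩ : ∃ g : SchwartzMap ℝ ℂ, 𝓕 g = f :=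
    ⟨𝓕⁻ f, FourierTransform.fourier_fourierInv_eq f⟩
  have hg := g.integrable (μ := volume)
  convert Submodule.add_mem _
    (integral_real_density_mem_transforms hg.re (-(2 * Real.pi)))
    (Submodule.smul_mem _ Complex.I
      (integral_real_density_mem_transforms hg.im (-(2 * Real.pi)))) using 1
  ext ξ
  have hb : ∀ {h : ℝ → ℝ}, Integrable h → Integrable fun x : ℝ =>
      Complex.exp ((-(2 * Real.pi) * ξ * x : ℝ) * Complex.I) * (h x : ℂ) := fun hh =>
    hh.ofReal.bdd_mul (c := 1) (by fun_prop)
      (.of_forall fun x => (Complex.norm_exp_ofReal_mul_I _).le)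
  rw [Pi.add_apply, Pi.smul_apply, smul_eq_mul, ← integral_const_mul,
    ← integral_add (hb hg.re) ((hb hg.im).const_mul _), SchwartzMap.fourier_coe,
    Real.fourier_real_eq_integral_exp_smul]
  refine integral_congr_ae (.of_forall fun x => ?_)
  have hz : g x = ((g x).re : ℂ) + (g x).im * Complex.I := (Complex.re_add_im _).symm
  simp only [smul_eq_mul]
  conv_lhs => rw [hz]
  rw [show -2 * Real.pi * x * ξ = -(2 * Real.pi) * ξ * x by ring]
  simp only [RCLike.re_eq_complex_re, RCLike.im_eq_complex_im]
  ring

/-- A symbol coincides near finitely many points with a single transform. -/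
lemma IsSymbol.exists_eq_near {F : ℝ → ℂ} (hF : IsSymbol F) {ι : Type*} [Fintype ι]
    {Λ : ι → ℝ} (hΛ : Function.Injective Λ) :
    ∃ μ : ComplexMeasure ℝ, ∀ i, ∀ᶠ y in 𝓝 (Λ i), F y = fourierStieltjes μ y := by
  classical
  choose μ hμ using fun i => hF (Λ i)
  have hψ : ∀ i, ∃ ψ ∈ transforms, ∀ j, ∀ᶠ y in 𝓝 (Λ j), ψ y = if i = j then 1 else 0 := by
    intro i
    have hnhds : (Set.range Λ \ {Λ i})ᶜ ∈ 𝓝 (Λ i) :=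
      ((Set.finite_range Λ).subset Set.sdiff_subset).isClosed.isOpen_compl.mem_nhds (by simp)
    obtain ⟨r, hr, hball⟩ := Metric.mem_nhds_iff.1 hnhds
    -- Every other frequency is at distance at least `r`, so the bump, supported within `r / 2`,
    -- vanishes on the `r / 2`-balls around them.
    let φ : ContDiffBump (Λ i) := ⟨r / 4, r / 2, by positivity, by linarith⟩
    have hsm : ContDiff ℝ (⊤ : ℕ∞) fun y => ((φ y : ℝ) : ℂ) :=
      Complex.ofRealCLM.contDiff.comp φ.contDiff
    have hcs : HasCompactSupport fun y => ((φ y : ℝ) : ℂ) :=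
      φ.hasCompactSupport.comp_left Complex.ofReal_zero
    refine ⟨_, schwartz_mem_transforms (hcs.toSchwartzMap hsm), fun j => ?_⟩
    by_cases hij : i = j
    · subst hij
      filter_upwards [φ.eventuallyEq_one] with y hy
      simpa using hy
    · have hdist : r ≤ dist (Λ j) (Λ i) := by
        by_contra! hlt
        exact hball hlt ⟨⟨j, rfl⟩, fun h => hij (hΛ h).symm⟩
      filter_upwards [Metric.ball_mem_nhds (Λ j) (half_pos hr)] with y hy
      have : φ.rOut ≤ dist y (Λ i) := by
        change r / 2 ≤ _
        have := dist_triangle_left (Λ j) (Λ i) y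
        have hy' : dist y (Λ j) < r / 2 := hy
        linarith
      simpa [hij] using φ.zero_of_le_dist this
  choose ψ hψ hψ' using hψ
  obtain ⟨ρ, hρ⟩ := exists_fourierStieltjes_eq (f := ∑ i, ψ i * fourierStieltjes (μ i))
    (Submodule.sum_mem _ fun i _ =>
      mul_mem_transforms (hψ i) (fourierStieltjes_mem_transforms (μ i)))
  refine ⟨ρ, fun j => ?_⟩
  filter_upwards [hμ j, eventually_all.2 fun i => hψ' i j] with y hy hy'
  simp [hρ, hy', hy]

lemma IsSymbol.continuous {F : ℝ → ℂ} (hF : IsSymbol F) : Continuous F := by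
  refine continuous_iff_continuousAt.2 fun x => ?_
  obtain ⟨μ, hμ⟩ := hF x
  exact (continuous_of_mem_transforms (fourierStieltjes_mem_transforms μ)).continuousAt.congr
    (hμ.mono fun y hy => hy.symm)

end Transform

/-! ### Functional calculus for diagonal elements. -/

section Diagonal

variable {ι : Type} {A : Type u} [NormedRing A] [NormedAlgebra ℂ A]

lemma spectrum_algHom_pi_subset (D : (ι → ℂ) →ₐ[ℂ] A) (z : ι → ℂ) :
    spectrum ℂ (D z) ⊆ Set.range z := by
  refine (AlgHom.spectrum_apply_subset D z).trans ?_
  rw [Pi.spectrum_eq]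
  refine Set.iUnion_subset fun i => ?_
  rintro w hw
  have : w = z i := (spectrum.scalar_eq (A := ℂ) (z i)).subset hw
  exact ⟨i, this.symm⟩

variable [Fintype ι]

lemma continuous_algHom_pi (D : (ι → ℂ) →ₐ[ℂ] A) : Continuous D :=
  D.toLinearMap.continuous_of_finiteDimensional

lemma exp_algHom_pi (D : (ι → ℂ) →ₐ[ℂ] A) (z : ι → ℂ) :
    NormedSpace.exp (D z) = D fun i => Complex.exp (z i) := by
  let := NormedAlgebra.restrictScalars ℚ ℂ (ι → ℂ)
  let := NormedAlgebra.restrictScalars ℚ ℂ A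
  rw [← NormedSpace.map_exp D (continuous_algHom_pi D)]
  congr 1
  ext i
  rw [Complex.exp_eq_exp_ℂ]
  exact Pi.coe_exp z i

/-- For a state `φ`, the function `Re φ(exp(ita))` is at most `1` and equals `1` at `t = 0`. Its
derivative there, `-Im φ(a)`, must vanish. -/
lemma isHermitianElement_of_norm_le_one (D : (ι → ℂ) →ₐ[ℂ] A) (Λ : ι → ℝ)
    (hD : ∀ t : ℝ, ‖D fun i => Complex.exp (Complex.I * (t * Λ i : ℝ))‖ ≤ 1) :
    IsHermitianElement (D fun i => (Λ i : ℂ)) := by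
  rintro _ ⟨φ, h1, hφ, rfl⟩
  let L : (ι → ℂ) →L[ℂ] ℂ := φ.comp ⟨D.toLinearMap, continuous_algHom_pi D⟩
  let R : (ι → ℂ) →L[ℝ] ℝ := Complex.reCLM.comp (L.restrictScalars ℝ)
  have hder : HasDerivAt (fun t : ℝ => fun i => Complex.exp (Complex.I * (t * Λ i : ℝ)))
      (fun i => Complex.I * Λ i) 0 := by
    refine hasDerivAt_pi.2 fun i => ?_
    have h : HasDerivAt (fun t : ℝ => Complex.I * (t * Λ i : ℝ)) (Complex.I * Λ i) 0 := by
      simpa using (((hasDerivAt_id (0 : ℝ)).mul_const (Λ i)).ofReal_comp).const_mul Complex.I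
    simpa using h.cexp
  have hR := R.hasFDerivAt.comp_hasDerivAt (0 : ℝ) hder
  have hmax : IsLocalMax (R ∘ fun t : ℝ => fun i => Complex.exp (Complex.I * (t * Λ i : ℝ))) 0 := by
    refine .of_forall fun t => ?_
    have e0 : R (fun i => Complex.exp (Complex.I * (0 * Λ i : ℝ))) = 1 := by
      have : (fun i => Complex.exp (Complex.I * (0 * Λ i : ℝ))) = 1 := by ext; simp
      rw [this]
      change (φ (D 1)).re = 1
      rw [map_one, h1, Complex.one_re]
    simp only [Function.comp_apply]
    rw [e0]
    refine (Complex.re_le_norm _).trans ((φ.le_opNorm _).trans ?_)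
    rw [hφ, one_mul]
    exact hD t
  have h0 := hmax.hasDerivAt_eq_zero hR
  have e1 : R (fun i => Complex.I * Λ i) = -(φ (D fun i => (Λ i : ℂ))).im := by
    have : (fun i => Complex.I * (Λ i : ℂ)) = Complex.I • fun i => (Λ i : ℂ) := rfl
    change (φ (D _)).re = _
    rw [this, map_smul, map_smul]
    simp
  linarith

lemma expIntegral_algHom_pi [CompleteSpace A] (μ : ComplexMeasure ℝ) (D : (ι → ℂ) →ₐ[ℂ] A)
    (Λ : ι → ℝ) :
    expIntegral μ (D fun i => (Λ i : ℂ)) = D fun i => fourierStieltjes μ (Λ i) := by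
  let f : BoundedContinuousFunction ℝ (ι → ℂ) :=
    .ofNormedAddCommGroup (fun t i => Complex.exp (Complex.I * (Λ i * t : ℝ))) (by fun_prop) 1
      fun t => (pi_norm_le_iff_of_nonneg zero_le_one).2 fun i => by
        rw [mul_comm, Complex.norm_exp_ofReal_mul_I]
  let L : (ι → ℂ) →L[ℂ] A := ⟨D.toLinearMap, continuous_algHom_pi D⟩
  have h1 : expIntegral μ (D fun i => (Λ i : ℂ)) = cintegral μ fun t => L (f t) := by
    unfold expIntegral
    congr 1
    ext t
    rw [← map_smul, exp_algHom_pi]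
    change D _ = D _
    congr 1
    ext i
    change Complex.exp (Complex.I * t * Λ i) = Complex.exp (Complex.I * (Λ i * t : ℝ))
    push_cast
    ring_nf
  rw [h1, cintegral_comp_clm]
  change D _ = D _
  congr 1
  ext i
  exact (cintegral_comp_clm μ (ContinuousLinearMap.proj (R := ℂ) (φ := fun _ : ι => ℂ) i) f).symm

/-- The spectrum of `D (F ∘ Λ)` lies among the values `F (Λ i)`, so universality turns a bound on
these values into a norm bound. -/
lemma IsUniversalSymbol.norm_algHom_pi_le [CompleteSpace A] [NormOneClass A] {F : ℝ → ℂ}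
    (hF : IsUniversalSymbol.{u} F) (D : (ι → ℂ) →ₐ[ℂ] A) {Λ : ι → ℝ}
    (hΛ : Function.Injective Λ)
    (hD : ∀ t : ℝ, ‖D fun i => Complex.exp (Complex.I * (t * Λ i : ℝ))‖ ≤ 1) {M : ℝ}
    (h0 : 0 ≤ M) (hM : ∀ i, ‖F (Λ i)‖ ≤ M) : ‖D fun i => F (Λ i)‖ ≤ M := by
  obtain ⟨μ, hμ⟩ := hF.isSymbol.exists_eq_near hΛ
  have hb : expIntegral μ (D fun i => (Λ i : ℂ)) = D fun i => F (Λ i) := by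
    rw [expIntegral_algHom_pi]
    congr 1
    ext i
    exact (hμ i).self_of_nhds.symm
  have hval : IsValueAt F (D fun i => (Λ i : ℂ)) (D fun i => F (Λ i)) := by
    refine ⟨μ, eventually_nhdsSet_iff_forall.2 fun x hx => ?_, hb⟩
    obtain ⟨i, hi⟩ := spectrum_algHom_pi_subset D _ hx
    rw [← Complex.ofReal_injective hi]
    exact hμ i
  have h := hF.enorm_eq_spectralRadius A _ (isHermitianElement_of_norm_le_one D Λ hD) _ hval
  rw [← Real.toNNReal_le_toNNReal_iff h0, ← ENNReal.coe_le_coe]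
  change ENNReal.ofReal _ ≤ _
  rw [ofReal_norm, h]
  refine iSup₂_le fun z hz => ?_
  obtain ⟨i, rfl⟩ := spectrum_algHom_pi_subset D _ hz
  rw [ENNReal.coe_le_coe, ← NNReal.coe_le_coe, Real.coe_toNNReal _ h0]
  exact hM i

end Diagonal

/-! ### Exponential sums and the multiplier inequality. -/

section Exponentials

/-- The bounded continuous function `t ↦ exp(i l t)`. -/
noncomputable def character (l : ℝ) : BoundedContinuousFunction ℝ ℂ :=
  .ofNormedAddCommGroup (fun t => Complex.exp (Complex.I * (l * t : ℝ))) (by fun_prop) 1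
    fun t => by rw [mul_comm, Complex.norm_exp_ofReal_mul_I]

lemma character_apply (l t : ℝ) : character l t = Complex.exp (Complex.I * (l * t : ℝ)) := rfl

/-- Dedekind's independence of characters; the derivative at `0` recovers the frequency, so distinct
frequencies give distinct characters. -/
lemma linearIndependent_character {ι : Type} {Λ : ι → ℝ} (hΛ : Function.Injective Λ) :
    LinearIndependent ℂ fun i => character (Λ i) := by
  let e : ℝ → Multiplicative ℝ →* ℂ := fun l =>
    { toFun := fun t => Complex.exp (Complex.I * (l * t.toAdd : ℝ))
      map_one' := by simp
      map_mul' := fun s t => by rw [← Complex.exp_add]; congr 1; push_cast [toAdd_mul]; ring }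
  have he : Function.Injective e := fun l l' h => by
    have hd : ∀ l : ℝ, HasDerivAt (fun t : ℝ => Complex.exp (Complex.I * (l * t : ℝ)))
        (Complex.I * l) 0 := fun l => by
      have h : HasDerivAt (fun t : ℝ => Complex.I * (l * t : ℝ)) (Complex.I * l) 0 := by
        simpa using (((hasDerivAt_id (0 : ℝ)).const_mul l).ofReal_comp).const_mul Complex.I
      simpa using h.cexp
    have hfun : (fun t : ℝ => Complex.exp (Complex.I * (l * t : ℝ))) =
        fun t : ℝ => Complex.exp (Complex.I * (l' * t : ℝ)) :=
      funext fun t => DFunLike.congr_fun h (Multiplicative.ofAdd t)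
    have := (hfun ▸ hd l).unique (hd l')
    simpa using this
  have h1 : LinearIndependent ℂ fun i => (e (Λ i) : Multiplicative ℝ → ℂ) :=
    (linearIndependent_monoidHom (Multiplicative ℝ) ℂ).comp (fun i => e (Λ i)) (he.comp hΛ)
  let toFun : BoundedContinuousFunction ℝ ℂ →ₗ[ℂ] (Multiplicative ℝ → ℂ) :=
    { toFun := fun f t => f t.toAdd
      map_add' := fun _ _ => rfl
      map_smul' := fun _ _ => rfl }
  exact LinearIndependent.of_comp toFun h1

/-- A universal symbol multiplies exponential sums boundedly: the multiplier norm on a finite set of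
frequencies is the maximum of its modulus. -/
theorem IsUniversalSymbol.norm_sum_le {F : ℝ → ℂ} (hF : IsUniversalSymbol.{u} F) {ι : Type}
    [Fintype ι] [Nonempty ι] {Λ : ι → ℝ} (hΛ : Function.Injective Λ) {M N : ℝ} (h0 : 0 ≤ M)
    (hM : ∀ i, ‖F (Λ i)‖ ≤ M) (p : ι → ℂ)
    (hp : ∀ t : ℝ, ‖∑ i, p i * Complex.exp (Complex.I * (Λ i * t : ℝ))‖ ≤ N) :
    ‖∑ i, F (Λ i) * p i‖ ≤ M * N := by
  classical
  let X := Submodule.span ℂ (Set.range fun i => character (Λ i))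
  let b : Module.Basis ι ℂ X := Module.Basis.span (linearIndependent_character hΛ)
  have hb : ∀ i, (b i : BoundedContinuousFunction ℝ ℂ) = character (Λ i) := fun i =>
    congrArg Subtype.val (Module.Basis.span_apply _ i)
  have : FiniteDimensional ℂ X := b.finiteDimensional_of_finite
  have : Nontrivial X := ⟨⟨b (Classical.arbitrary ι), 0, b.ne_zero _⟩⟩
  have : CompleteSpace X := FiniteDimensional.complete ℂ X
  let D₀ : (ι → ℂ) →ₐ[ℂ] (X →L[ℂ] X) :=
    ((Module.End.toContinuousLinearMap X).toAlgHom.comp (Matrix.toLinAlgEquiv b).toAlgHom).comp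
      (Matrix.diagonalAlgHom ℂ)
  have hD₀ : ∀ z i, D₀ z (b i) = z i • b i := fun z i => by
    change Matrix.toLinAlgEquiv b (Matrix.diagonal z) (b i) = _
    rw [Matrix.toLinAlgEquiv_self, Finset.sum_eq_single i]
    · rw [Matrix.diagonal_apply_eq]
    · intro j _ hj
      rw [Matrix.diagonal_apply_ne _ hj, zero_smul]
    · simp
  have hsum : ∀ z (q : ι → ℂ) (t : ℝ), (D₀ z (∑ i, q i • b i) : BoundedContinuousFunction ℝ ℂ) t =
      ∑ i, z i * q i * Complex.exp (Complex.I * (Λ i * t : ℝ)) := fun z q t => by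
    simp only [map_sum, map_smul, hD₀, Submodule.coe_sum, Submodule.coe_smul, hb]
    rw [BoundedContinuousFunction.coe_sum, Finset.sum_apply]
    refine Finset.sum_congr rfl fun i _ => ?_
    simp only [BoundedContinuousFunction.coe_smul, character_apply, smul_eq_mul]
    ring
  have hsum1 : ∀ (q : ι → ℂ) (t : ℝ), ((∑ i, q i • b i : X) : BoundedContinuousFunction ℝ ℂ) t =
      ∑ i, q i * Complex.exp (Complex.I * (Λ i * t : ℝ)) := fun q t => by
    simpa using hsum 1 q t
  -- Universality speaks of algebras in `Type u`, while these operators live in `Type`.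
  let D : (ι → ℂ) →ₐ[ℂ] ULift.{u} (X →L[ℂ] X) :=
    (ULift.algEquiv (R := ℂ) (A := X →L[ℂ] X)).symm.toAlgHom.comp D₀
  have hDnorm : ∀ z, ‖D z‖ = ‖D₀ z‖ := fun z => rfl
  -- This operator is translation by `t`, which does not increase the sup norm.
  have hD : ∀ t : ℝ, ‖D fun i => Complex.exp (Complex.I * (t * Λ i : ℝ))‖ ≤ 1 := fun t => by
    rw [hDnorm]
    refine ContinuousLinearMap.opNorm_le_bound _ zero_le_one fun x => ?_
    rw [one_mul, ← b.sum_repr x]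
    refine (BoundedContinuousFunction.norm_le (norm_nonneg _)).2 fun s => ?_
    refine (congrArg norm (hsum _ _ s)).le.trans ?_
    refine le_trans (le_of_eq ?_) (BoundedContinuousFunction.norm_coe_le_norm _ (s + t))
    refine Eq.trans ?_ (congrArg norm (hsum1 _ (s + t))).symm
    congr 1
    refine Finset.sum_congr rfl fun i _ => ?_
    rw [mul_assoc, mul_left_comm, ← Complex.exp_add]
    congr 2
    push_cast
    ring
  have hfin := hF.norm_algHom_pi_le (A := ULift.{u} (X →L[ℂ] X)) D hΛ hD h0 hM
  have hx : ‖∑ i, p i • b i‖ ≤ N := by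
    refine (BoundedContinuousFunction.norm_le ((norm_nonneg _).trans (hp 0))).2 fun s => ?_
    exact (congrArg norm (hsum1 p s)).le.trans (hp s)
  calc ‖∑ i, F (Λ i) * p i‖
      = ‖(D₀ (fun i => F (Λ i)) (∑ i, p i • b i) : BoundedContinuousFunction ℝ ℂ) 0‖ := by
        rw [hsum]; simp
    _ ≤ ‖D₀ (fun i => F (Λ i)) (∑ i, p i • b i)‖ := BoundedContinuousFunction.norm_coe_le_norm _ 0
    _ ≤ ‖D₀ fun i => F (Λ i)‖ * ‖∑ i, p i • b i‖ := ContinuousLinearMap.le_opNorm _ _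
    _ ≤ M * N := mul_le_mul hfin hx (norm_nonneg _) h0

end Exponentials

/-! ### Real functions constrained on three-term progressions. -/

section Line

variable {g : ℝ → ℝ}

/-- Beyond the last point `s` of the level `g 0`, `hA` makes `g` locally constant, so `g` would jump
at `s`. -/
lemma eq_of_locally_symmetric (hg : Continuous g)
    (hA : ∀ x d, g (x + d) ≤ g x → g (x - d) ≤ g x → g (x + d) = g (x - d)) {r : ℝ} (hr : 0 < r)
    (hmax : ∀ t, |t| ≤ r → g t ≤ g 0) : g r = g 0 := by
  have heven : ∀ t, |t| ≤ r → g (-t) = g t := fun t ht => by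
    have := hA 0 t (by simpa using hmax t ht) (by simpa using hmax (-t) (by simpa using ht))
    simpa using this.symm
  by_contra hne
  set S : Set ℝ := Set.Icc 0 r ∩ g ⁻¹' {g 0}
  have hScomp : IsCompact S := isCompact_Icc.inter_right (isClosed_singleton.preimage hg)
  have hSne : S.Nonempty := ⟨0, ⟨le_rfl, hr.le⟩, rfl⟩
  obtain ⟨⟨hs0, hsr⟩, hsg⟩ := hScomp.sSup_mem hSne
  set s := sSup S
  have hsg : g s = g 0 := hsg
  have hsr' : s < r := lt_of_le_of_ne hsr fun h => hne (h ▸ hsg)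
  have hlt : ∀ t ∈ Set.Ioo s r, g t < g 0 := fun t ht => by
    refine lt_of_le_of_ne (hmax t (abs_le.2 ⟨by linarith [ht.1], ht.2.le⟩)) fun h => ?_
    exact absurd (le_csSup hScomp.bddAbove
      (⟨⟨by linarith [ht.1], ht.2.le⟩, h⟩ : t ∈ S)) (not_le.2 ht.1)
  -- The points `-t` and `v` are symmetric about `(v - t) / 2`, which is near `0`, so `g` is larger
  -- there; `hA` gives `g v = g (-t) = g t`.
  have hloc : ∀ t ∈ Set.Ioo s r, ∀ᶠ v in 𝓝 t, g v = g t := fun t ht => by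
    have h1 : ∀ᶠ p : ℝ × ℝ in 𝓝 (0, t), g p.2 < g p.1 :=
      (hg.comp continuous_snd).continuousAt.eventually_lt
        (hg.comp continuous_fst).continuousAt (hlt t ht)
    have h2 : ∀ᶠ v in 𝓝 t, g v < g ((v - t) / 2) :=
      (Continuous.tendsto' (f := fun v : ℝ => ((v - t) / 2, v)) (by fun_prop) t (0, t)
        (by simp)).eventually h1
    have h3 : ∀ᶠ v in 𝓝 t, g t < g ((v - t) / 2) :=
      (Continuous.tendsto' (f := fun v : ℝ => ((v - t) / 2, t)) (by fun_prop) t (0, t)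
        (by simp)).eventually h1
    filter_upwards [h2, h3] with v hv2 hv3
    have e := heven t (abs_le.2 ⟨by linarith [ht.1], ht.2.le⟩)
    have := hA ((v - t) / 2) ((v + t) / 2)
    ring_nf at this hv2 hv3
    rw [e] at this
    exact this hv2.le hv3.le
  have hconst : ∀ t ∈ Set.Ioo s r, g t = g ((s + r) / 2) := fun t ht => by
    have hd : ∀ t ∈ Set.Ioo s r, HasDerivAt g 0 t := fun t ht =>
      (hasDerivAt_const t (g t)).congr_of_eventuallyEq (hloc t ht)
    exact isOpen_Ioo.is_const_of_deriv_eq_zero isPreconnected_Ioo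
      (fun t ht => (hd t ht).differentiableAt.differentiableWithinAt)
      (fun t ht => (hd t ht).deriv) ht ⟨by linarith, by linarith⟩
  have hcl := Set.EqOn.closure (s := Set.Ioo s r) (f := g) (g := fun _ => g ((s + r) / 2))
    hconst hg continuous_const
  rw [closure_Ioo hsr'.ne] at hcl
  have h4 := hcl ⟨le_rfl, hsr'.le⟩
  have h5 := hlt ((s + r) / 2) ⟨by linarith, by linarith⟩
  simp only at h4
  linarith

/-- Otherwise the maximum over `[p, q]` is attained at an interior point `y`, and
`eq_of_locally_symmetric` carries its value to the endpoint nearest to `y`. -/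
lemma le_max_of_symmetric (hg : Continuous g)
    (hA : ∀ x d, g (x + d) ≤ g x → g (x - d) ≤ g x → g (x + d) = g (x - d)) {p z q : ℝ}
    (hpz : p < z) (hzq : z < q) : g z ≤ max (g p) (g q) := by
  by_contra! h
  obtain ⟨hp, hq⟩ := max_lt_iff.1 h
  obtain ⟨y, hy, hmax⟩ := isCompact_Icc.exists_isMaxOn
    (Set.nonempty_Icc.2 (hpz.trans hzq).le) hg.continuousOn
  have hzy : g z ≤ g y := hmax ⟨hpz.le, hzq.le⟩
  have hpy : p < y := lt_of_le_of_ne hy.1 fun h => by subst h; linarith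
  have hyq : y < q := lt_of_le_of_ne hy.2 fun h => by subst h; linarith
  have hr : 0 < min (y - p) (q - y) := lt_min (by linarith) (by linarith)
  have hmax' : ∀ t, |t| ≤ min (y - p) (q - y) → g (y + t) ≤ g (y + 0) := fun t ht => by
    rw [le_min_iff, abs_le, abs_le] at ht
    simpa using hmax (⟨by linarith [ht.1.1], by linarith [ht.2.2]⟩ : y + t ∈ Set.Icc p q)
  have h1 := eq_of_locally_symmetric (g := fun t => g (y + t)) (by fun_prop)
    (fun x d h1 h2 => by
      simpa [add_assoc, add_sub_assoc] using hA (y + x) d (by simpa [add_assoc] using h1)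
        (by simpa [add_sub_assoc] using h2)) hr hmax'
  have h2 := eq_of_locally_symmetric (g := fun t => g (y - t)) (by fun_prop)
    (fun x d h1 h2 => by
      have := hA (y - x) d (by convert h2 using 2; ring) (by convert h1 using 2; ring)
      convert this.symm using 2 <;> ring) hr
    (fun t ht => by simpa [sub_eq_add_neg] using hmax' (-t) (by simpa using ht))
  simp only [add_zero, sub_zero] at h1 h2
  rcases min_choice (y - p) (q - y) with h | h <;> rw [h] at h1 h2
  · rw [show y - (y - p) = p by ring] at h2; linarith
  · rw [show y + (q - y) = q by ring] at h1; linarith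

/-- Quasiconvexity gives the weak inequality. If equality held, reflection about the last point `w`
of the level `g u` would produce a later point of that level. -/
lemma lt_of_lt_of_le_of_descent (hg : Continuous g)
    (hA : ∀ x d, g (x + d) ≤ g x → g (x - d) ≤ g x → g (x + d) = g (x - d)) {u v x y : ℝ}
    (huv : u < v) (hvx : v ≤ x) (hxy : x < y) (h : g y < g x) : g v < g u := by
  have hQ : ∀ {p z q}, p < z → z < q → g z ≤ max (g p) (g q) := le_max_of_symmetric hg hA
  have hmono : ∀ {t x}, t ≤ x → x < y → g y < g x → g x ≤ g t := fun {t x} htx hxy h => by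
    rcases htx.eq_or_lt with rfl | htx
    · exact le_rfl
    · exact (le_max_iff.1 (hQ htx hxy)).resolve_right (not_le.2 h)
  have hvy : g y < g v := h.trans_le (hmono hvx hxy h)
  have hvy' : v < y := hvx.trans_lt hxy
  refine lt_of_le_of_ne (hmono huv.le hvy' hvy) fun heq => ?_
  set S : Set ℝ := Set.Icc u y ∩ g ⁻¹' {g u}
  have hScomp : IsCompact S := isCompact_Icc.inter_right (isClosed_singleton.preimage hg)
  have hvS : v ∈ S := ⟨⟨huv.le, hvy'.le⟩, heq⟩
  obtain ⟨⟨-, hwy⟩, hwg⟩ := hScomp.sSup_mem ⟨v, hvS⟩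
  have hvw : v ≤ sSup S := le_csSup hScomp.bddAbove hvS
  set w := sSup S
  have hwg : g w = g u := hwg
  have hyw : g y < g w := by rw [hwg, ← heq]; exact hvy
  have hwy' : w < y := lt_of_le_of_ne hwy fun h => by rw [h] at hyw; exact lt_irrefl _ hyw
  have hle : ∀ t, u < t → t < y → g t ≤ g u := fun t h1 h2 => by
    have := hQ h1 h2
    rwa [max_eq_left (by linarith)] at this
  obtain ⟨d, hd, hdlt⟩ := exists_between (lt_min (sub_pos.2 (huv.trans_le hvw)) (sub_pos.2 hwy'))
  obtain ⟨hd1, hd2⟩ := lt_min_iff.1 hdlt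
  have e1 : g (w - d) = g u := le_antisymm (hle _ (by linarith) (by linarith))
    (hwg ▸ hmono (by linarith) hwy' hyw)
  have e2 : g (w + d) ≤ g u := hle _ (by linarith) (by linarith)
  have e3 := hA w d (by rw [hwg]; exact e2) (by rw [hwg, e1])
  have : w + d ∈ S := ⟨⟨by linarith, by linarith⟩, by rw [Set.mem_preimage, e3, e1]; rfl⟩
  linarith [le_csSup hScomp.bddAbove this]

/-- If `L` were a finite supremum, take `z` with `g z` close to `L` and reflect `y` about `z`: in
the limit `hB` would give `L² ≤ g y * L`, although `g y < L`. -/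
lemma not_bddAbove_of_descent (hg : Continuous g) (h0 : ∀ x, 0 ≤ g x)
    (hA : ∀ x d, g (x + d) ≤ g x → g (x - d) ≤ g x → g (x + d) = g (x - d))
    (hB : ∀ x d, g x ≤ g (x - d) → g (x + d) ≤ g (x - d) →
      2 * g x ^ 2 - g (x - d) ^ 2 ≤ g (x + d) * g (x - d)) {x y : ℝ}
    (hxy : x < y) (h : g y < g x) : ¬ BddAbove (g '' Set.Iic x) := by
  intro hbdd
  have hne : (g '' Set.Iic x).Nonempty := ⟨g x, x, Set.mem_Iic.2 le_rfl, rfl⟩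
  set L := sSup (g '' Set.Iic x)
  have hLx : g x ≤ L := le_csSup hbdd ⟨x, Set.mem_Iic.2 le_rfl, rfl⟩
  have hLy : g y < L := h.trans_le hLx
  have hL : 0 < L := (h0 y).trans_lt hLy
  -- With `δ = L - g y`, `hB` gives `2 (L - δ/8)² - L² ≤ g y * L`, hence `δ L ≤ δ L / 2`, which is
  -- absurd.
  obtain ⟨_, ⟨z, hz, rfl⟩, hlt⟩ := exists_lt_of_lt_csSup hne
    (show L - (L - g y) / 8 < L by linarith)
  have hz : z ≤ x := hz
  have hd : z - (y - z) < z := by linarith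
  have h1 := lt_of_lt_of_le_of_descent hg hA hd hz hxy h
  have h2 : g (z - (y - z)) ≤ L := le_csSup hbdd ⟨_, Set.mem_Iic.2 (hd.le.trans hz), rfl⟩
  have h3 := hB z (y - z) h1.le (by rw [show z + (y - z) = y by ring]; linarith)
  rw [show z + (y - z) = y by ring] at h3
  have h4 : g y * g (z - (y - z)) ≤ g y * L := by gcongr; exact h0 y
  have h5 : g (z - (y - z)) ^ 2 ≤ L ^ 2 := by gcongr; exact h0 _
  have h6 : (L - (L - g y) / 8) ^ 2 ≤ g z ^ 2 := by gcongr; linarith [h0 y]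
  nlinarith [h0 y, mul_pos hL (sub_pos.2 hLy)]

/-- The points of the line from which `g` takes a smaller value further to the right. -/
def descending (g : ℝ → ℝ) : Set ℝ := {x | ∃ y, x < y ∧ g y < g x}

/-- The points of the line from which `g` takes a smaller value further to the left. -/
def ascending (g : ℝ → ℝ) : Set ℝ := {x | ∃ y, y < x ∧ g y < g x}

lemma isOpen_descending (hg : Continuous g) : IsOpen (descending g) := by
  rw [show descending g = ⋃ y, {x | x < y} ∩ {x | g y < g x} by ext; simp [descending]]
  exact isOpen_iUnion fun y => (isOpen_lt continuous_id continuous_const).inter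
    (isOpen_lt continuous_const hg)

lemma isOpen_ascending (hg : Continuous g) : IsOpen (ascending g) := by
  rw [show ascending g = ⋃ y, {x | y < x} ∩ {x | g y < g x} by ext; simp [ascending]]
  exact isOpen_iUnion fun y => (isOpen_lt continuous_const continuous_id).inter
    (isOpen_lt continuous_const hg)

lemma ascending_eq_preimage : ascending g = Neg.neg ⁻¹' descending fun t => g (-t) := by
  ext x
  constructor
  · rintro ⟨y, h, h'⟩
    exact ⟨-y, by simpa using h, by simpa using h'⟩
  · rintro ⟨y, h, h'⟩
    exact ⟨-y, by linarith, by simpa using h'⟩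

lemma descending_structure (hg : Continuous g) (h0 : ∀ x, 0 ≤ g x)
    (hA : ∀ x d, g (x + d) ≤ g x → g (x - d) ≤ g x → g (x + d) = g (x - d))
    (hB : ∀ x d, g x ≤ g (x - d) → g (x + d) ≤ g (x - d) →
      2 * g x ^ 2 - g (x - d) ^ 2 ≤ g (x + d) * g (x - d)) :
    IsLowerSet (descending g) ∧ StrictAntiOn g (descending g) ∧
      ((descending g).Nonempty → ¬ BddAbove (g '' descending g)) := by
  have hlow : IsLowerSet (descending g) := by
    rintro x t htx ⟨y, hxy, h⟩
    rcases htx.eq_or_lt with rfl | htx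
    · exact ⟨y, hxy, h⟩
    · exact ⟨x, htx, lt_of_lt_of_le_of_descent hg hA htx le_rfl hxy h⟩
  refine ⟨hlow, ?_, ?_⟩
  · rintro u - v ⟨y, hvy, h⟩ huv
    exact lt_of_lt_of_le_of_descent hg hA huv le_rfl hvy h
  · rintro ⟨x, y, hxy, h⟩ hb
    refine not_bddAbove_of_descent hg h0 hA hB hxy h (hb.mono (Set.image_mono ?_))
    exact fun t ht => hlow ht ⟨y, hxy, h⟩

lemma ascending_structure (hg : Continuous g) (h0 : ∀ x, 0 ≤ g x)
    (hA : ∀ x d, g (x + d) ≤ g x → g (x - d) ≤ g x → g (x + d) = g (x - d))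
    (hB : ∀ x d, g x ≤ g (x - d) → g (x + d) ≤ g (x - d) →
      2 * g x ^ 2 - g (x - d) ^ 2 ≤ g (x + d) * g (x - d)) :
    IsUpperSet (ascending g) ∧ StrictMonoOn g (ascending g) ∧
      ((ascending g).Nonempty → ¬ BddAbove (g '' ascending g)) := by
  obtain ⟨h1, h2, h3⟩ := descending_structure (g := fun t => g (-t)) (by fun_prop)
    (fun _ => h0 _)
    (fun x d h1 h2 => by
      have := hA (-x) d (by convert h2 using 2; ring) (by convert h1 using 2; ring)
      convert this.symm using 2 <;> ring)
    (fun x d h1 h2 => by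
      -- Unlike `hA`, `hB` singles out the endpoint `x - d`, so `d` changes sign with `x`.
      have := hB (-x) (-d) (by convert h1 using 2; ring) (by convert h2 using 2 <;> ring)
      convert this using 3 <;> ring_nf)
  have e := ascending_eq_preimage (g := g)
  have hmem : ∀ {x}, x ∈ ascending g → -x ∈ descending fun t => g (-t) := fun {x} hx => by
    rw [e] at hx; exact hx
  refine ⟨fun x t hxt hx => ?_, fun u hu v hv huv => ?_, ?_⟩
  · rw [e]; exact h1 (neg_le_neg hxt) (hmem hx)
  · simpa using h2 (hmem hv) (hmem hu) (neg_lt_neg huv)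
  · rintro ⟨x, hx⟩ hb
    refine h3 ⟨-x, hmem hx⟩ (hb.mono ?_)
    rintro _ ⟨t, ht, rfl⟩
    exact ⟨-t, by rw [e]; simpa using ht, rfl⟩

/-- The shape of a nonnegative continuous function on the line subject to the two constraints that
universality imposes on three-term arithmetic progressions. -/
theorem structure_of_three_point (hg : Continuous g) (h0 : ∀ x, 0 ≤ g x)
    (hA : ∀ x d, g (x + d) ≤ g x → g (x - d) ≤ g x → g (x + d) = g (x - d))
    (hB : ∀ x d, g x ≤ g (x - d) → g (x + d) ≤ g (x - d) →
      2 * g x ^ 2 - g (x - d) ^ 2 ≤ g (x + d) * g (x - d)) :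
    IsPreconnected {x | g x = ⨅ t, g t} ∧ (components {x | g x = ⨅ t, g t}ᶜ).encard ≤ 2 ∧
      ∀ U ∈ components {x | g x = ⨅ t, g t}ᶜ,
        (StrictMonoOn g U ∨ StrictAntiOn g U) ∧ ¬ BddAbove (g '' U) := by
  have hbdd : BddBelow (Set.range g) := ⟨0, by rintro _ ⟨x, rfl⟩; exact h0 x⟩
  have hinf : ∀ x, ⨅ t, g t ≤ g x := ciInf_le hbdd
  have hQ : ∀ {p z q}, p < z → z < q → g z ≤ max (g p) (g q) := le_max_of_symmetric hg hA
  obtain ⟨d1, d2, d3⟩ := descending_structure hg h0 hA hB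
  obtain ⟨a1, a2, a3⟩ := ascending_structure hg h0 hA hB
  have hcompl : {x | g x = ⨅ t, g t}ᶜ = descending g ∪ ascending g := by
    ext x
    constructor
    · intro hx
      obtain ⟨y, hy⟩ := exists_lt_of_ciInf_lt (lt_of_le_of_ne (hinf x) (Ne.symm hx))
      rcases lt_trichotomy x y with h | rfl | h
      · exact Or.inl ⟨y, h, hy⟩
      · exact absurd hy (lt_irrefl _)
      · exact Or.inr ⟨y, h, hy⟩
    · rintro (⟨y, -, hy⟩ | ⟨y, -, hy⟩) hx <;> exact absurd (hinf y) (not_le.2 (hx ▸ hy))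
  -- A common point would lie strictly above `g` at points on both sides, against quasiconvexity.
  have hdisj : Disjoint (descending g) (ascending g) := by
    rw [Set.disjoint_left]
    rintro x ⟨y, hxy, hy⟩ ⟨z, hzx, hz⟩
    exact absurd (hQ hzx hxy) (not_le.2 (max_lt hz hy))
  have hcomp : ∀ x ∈ descending g ∪ ascending g,
      (x ∈ descending g ∧ connectedComponentIn (descending g ∪ ascending g) x = descending g) ∨
      (x ∈ ascending g ∧ connectedComponentIn (descending g ∪ ascending g) x = ascending g) := by
    intro x hx
    have hpre := isPreconnected_connectedComponentIn (F := descending g ∪ ascending g) (x := x)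
    have hsub := connectedComponentIn_subset (descending g ∪ ascending g) x
    have hself := mem_connectedComponentIn hx
    rcases hx with hx | hx
    · refine Or.inl ⟨hx, Set.Subset.antisymm ?_ ?_⟩
      · exact hpre.subset_left_of_subset_union (isOpen_descending hg) (isOpen_ascending hg) hdisj
          hsub ⟨x, hself, hx⟩
      · exact d1.ordConnected.isPreconnected.subset_connectedComponentIn hx
          Set.subset_union_left
    · refine Or.inr ⟨hx, Set.Subset.antisymm ?_ ?_⟩
      · exact hpre.subset_right_of_subset_union (isOpen_descending hg) (isOpen_ascending hg) hdisj
          hsub ⟨x, hself, hx⟩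
      · exact a1.ordConnected.isPreconnected.subset_connectedComponentIn hx
          Set.subset_union_right
  rw [hcompl]
  refine ⟨Set.OrdConnected.isPreconnected ⟨fun p hp q hq z hz => ?_⟩, ?_, ?_⟩
  · rcases hz.1.eq_or_lt with rfl | h1
    · exact hp
    rcases hz.2.eq_or_lt with rfl | h2
    · exact hq
    refine le_antisymm ?_ (hinf z)
    have := hQ h1 h2
    rwa [show g p = _ from hp, show g q = _ from hq, max_self] at this
  · refine (Set.encard_le_encard (t := {descending g, ascending g}) ?_).trans
      ((Set.encard_insert_le _ _).trans (by rw [Set.encard_singleton, one_add_one_eq_two]))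
    rintro U ⟨x, hx, rfl⟩
    rcases hcomp x hx with h | h
    · exact Or.inl h.2
    · exact Or.inr h.2
  · rintro U ⟨x, hx, rfl⟩
    rcases hcomp x hx with h | h <;> rw [h.2]
    · exact ⟨Or.inr d2, d3 ⟨x, h.1⟩⟩
    · exact ⟨Or.inl a2, a3 ⟨x, h.1⟩⟩

end Line

/-! ### The two inequalities on three-term progressions. -/

section ThreePoint

variable {F : ℝ → ℂ}

lemma injective_progression {x d : ℝ} (hd : d ≠ 0) :
    Function.Injective fun i : Fin 3 => x + (i : ℝ) * d := fun i j h => by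
  have h' : (i : ℝ) * d = (j : ℝ) * d := add_left_cancel h
  exact Fin.ext (by exact_mod_cast mul_right_cancel₀ hd h')

/-- First-order consequence of the multiplier bound at a point of a three-term progression where the
modulus is maximal. -/
lemma IsUniversalSymbol.re_sum_div_nonpos (hF : IsUniversalSymbol.{u} F) {x d : ℝ} (hd : d ≠ 0)
    (j : Fin 3) (hj : F (x + (j : ℝ) * d) ≠ 0)
    (hmax : ∀ i : Fin 3, ‖F (x + (i : ℝ) * d)‖ ≤ ‖F (x + (j : ℝ) * d)‖) (q : Fin 3 → ℂ)
    (hq : ∀ w : ℂ, ‖w‖ = 1 → (starRingEnd ℂ (w ^ (j : ℕ)) * ∑ i, q i * w ^ (i : ℕ)).re ≤ 0) :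
    ((∑ i : Fin 3, F (x + (i : ℝ) * d) * q i) / F (x + (j : ℝ) * d)).re ≤ 0 := by
  set f : Fin 3 → ℂ := fun i => F (x + (i : ℝ) * d)
  set C := ∑ i, ‖q i‖
  have key : ∀ ε : ℝ, 0 < ε → ((∑ i, f i * q i) / f j).re ≤ ε * C ^ 2 := by
    intro ε hε
    -- Up to a unimodular factor the sum is `1 + ε s` with `Re s ≤ 0` and `|s| ≤ C`, so its sup norm
    -- exceeds `1` only at order `ε²`.
    let p : Fin 3 → ℂ := fun i => (if i = j then 1 else 0) + ε * q i
    have hp : ∀ t : ℝ,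
        ‖∑ i, p i * Complex.exp (Complex.I * ((x + (i : ℝ) * d) * t : ℝ))‖ ≤ 1 + ε ^ 2 * C ^ 2 := by
      intro t
      set w := Complex.exp ((d * t : ℝ) * Complex.I)
      set v := Complex.exp ((x * t : ℝ) * Complex.I)
      have hw : ‖w‖ = 1 := Complex.norm_exp_ofReal_mul_I _
      have hv : ‖v‖ = 1 := Complex.norm_exp_ofReal_mul_I _
      have hexp : ∀ i : Fin 3,
          Complex.exp (Complex.I * ((x + (i : ℝ) * d) * t : ℝ)) = v * w ^ (i : ℕ) := fun i => by
        rw [← Complex.exp_nat_mul, ← Complex.exp_add]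
        congr 1
        push_cast
        ring
      set u := starRingEnd ℂ (w ^ (j : ℕ))
      have hu : ‖u‖ = 1 := by rw [RCLike.norm_conj, norm_pow, hw, one_pow]
      have huw : u * w ^ (j : ℕ) = 1 := by
        rw [Complex.conj_mul', norm_pow, hw]; simp
      set s := u * ∑ i, q i * w ^ (i : ℕ)
      have hs : s.re ≤ 0 := hq w hw
      have hsC : ‖s‖ ≤ C := by
        rw [norm_mul, hu, one_mul]
        refine (_root_.norm_sum_le _ _).trans (Finset.sum_le_sum fun i _ => ?_)
        rw [norm_mul, norm_pow, hw, one_pow, mul_one]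
      have hsum : u * ∑ i, p i * w ^ (i : ℕ) = 1 + ε * s := by
        simp only [p, add_mul, Finset.sum_add_distrib, mul_add, ite_mul, one_mul, zero_mul,
          Finset.sum_ite_eq', Finset.mem_univ, if_true, huw]
        simp only [s, mul_assoc, ← Finset.mul_sum]
        ring
      have hnorm : ‖∑ i, p i * Complex.exp (Complex.I * ((x + (i : ℝ) * d) * t : ℝ))‖ =
          ‖1 + (ε : ℂ) * s‖ := by
        rw [← hsum, norm_mul, hu, one_mul]
        simp only [hexp, mul_left_comm _ v, ← Finset.mul_sum]
        rw [norm_mul, hv, one_mul]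
      rw [hnorm]
      have hsq : ‖s‖ ^ 2 ≤ C ^ 2 := by gcongr
      have h2 : ‖1 + (ε : ℂ) * s‖ ^ 2 ≤ (1 + ε ^ 2 * C ^ 2) ^ 2 := by
        rw [Complex.sq_norm, Complex.normSq_apply] at *
        simp only [Complex.add_re, Complex.one_re, Complex.re_ofReal_mul, Complex.add_im,
          Complex.one_im, Complex.im_ofReal_mul, zero_add]
        have h3 : ε * s.re ≤ 0 := mul_nonpos_of_nonneg_of_nonpos hε.le hs
        have h4 := mul_le_mul_of_nonneg_left hsq (sq_nonneg ε)
        nlinarith [sq_nonneg (ε ^ 2 * C ^ 2)]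
      exact abs_le_of_sq_le_sq' h2 (by positivity) |>.2
    have h := hF.norm_sum_le (injective_progression (x := x) hd) (norm_nonneg _) hmax p hp
    have hsum : ∑ i : Fin 3, F (x + (i : ℝ) * d) * p i =
        f j * (1 + ε * ((∑ i, f i * q i) / f j)) := by
      have hj' : f j ≠ 0 := hj
      rw [mul_add, mul_one, mul_left_comm, mul_div_cancel₀ _ hj', Finset.mul_sum]
      simp only [p, mul_add, Finset.sum_add_distrib, mul_ite, mul_one, mul_zero,
        Finset.sum_ite_eq', Finset.mem_univ, if_true, mul_left_comm _ (ε : ℂ)]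
      rfl
    rw [hsum, norm_mul] at h
    have h1 := le_of_mul_le_mul_left h (norm_pos_iff.2 hj)
    have h2 := (Complex.re_le_norm _).trans h1
    rw [Complex.add_re, Complex.one_re, Complex.re_ofReal_mul] at h2
    have h3 : ε * ((∑ i, f i * q i) / f j).re ≤ ε * (ε * C ^ 2) := by linarith
    exact le_of_mul_le_mul_left h3 hε
  by_contra! hpos
  set r := ((∑ i, f i * q i) / f j).re
  have hC : 0 ≤ C ^ 2 := sq_nonneg C
  have h := key (r / (2 * (C ^ 2 + 1))) (by positivity)
  rw [div_mul_eq_mul_div, le_div_iff₀ (by positivity)] at h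
  nlinarith

lemma IsUniversalSymbol.norm_symm (hF : IsUniversalSymbol.{u} F) (x d : ℝ)
    (h1 : ‖F (x + d)‖ ≤ ‖F x‖) (h2 : ‖F (x - d)‖ ≤ ‖F x‖) : ‖F (x + d)‖ = ‖F (x - d)‖ := by
  rcases eq_or_ne d 0 with rfl | hd
  · simp
  rcases eq_or_ne (F x) 0 with hx | hx
  · rw [hx, norm_zero] at h1 h2
    rw [le_antisymm h1 (norm_nonneg _), le_antisymm h2 (norm_nonneg _)]
  set a := F (x - d) / F x with ha
  set b := F (x + d) / F x with hb
  -- For any `α`, `α w̄ - conj(α w̄)` is purely imaginary on the circle, so the test coefficients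
  -- are admissible. This `α` makes the resulting quantity `‖a - conj b‖²`, forcing `a = conj b`.
  set α := starRingEnd ℂ (a - starRingEnd ℂ b) with hα
  have e0 : x - d + ((0 : Fin 3) : ℝ) * d = x - d := by simp
  have e1 : x - d + ((1 : Fin 3) : ℝ) * d = x := by simp
  have e2 : x - d + ((2 : Fin 3) : ℝ) * d = x + d := by simp; ring
  have h := hF.re_sum_div_nonpos (x := x - d) hd 1 (by rwa [e1])
    (fun i => by
      rw [e1]
      fin_cases i
      · simpa using h2
      · simp
      · change ‖F (x - d + ((2 : Fin 3) : ℝ) * d)‖ ≤ _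
        rwa [e2])
    ![α, 0, -starRingEnd ℂ α] (fun w hw => by
      have hww : starRingEnd ℂ w * w = 1 := by rw [Complex.conj_mul', hw]; simp
      have : starRingEnd ℂ (w ^ ((1 : Fin 3) : ℕ)) *
          ∑ i : Fin 3, ![α, 0, -starRingEnd ℂ α] i * w ^ (i : ℕ) =
          α * starRingEnd ℂ w - starRingEnd ℂ (α * starRingEnd ℂ w) := by
        simp [Fin.sum_univ_three]
        linear_combination (-starRingEnd ℂ α * w) * hww
      rw [this]
      simp)
  have e : (∑ i : Fin 3, F (x - d + (i : ℝ) * d) * ![α, 0, -starRingEnd ℂ α] i) / F x =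
      α * a - starRingEnd ℂ α * b := by
    rw [Fin.sum_univ_three]
    simp only [Fin.val_zero, Fin.val_one, Fin.val_two] at e0 e1 e2 ⊢
    rw [e0, e1, e2, ha, hb]
    simp
    ring
  rw [e1, e] at h
  have hre : (α * a - starRingEnd ℂ α * b).re = ‖a - starRingEnd ℂ b‖ ^ 2 := by
    rw [Complex.sq_norm, Complex.normSq_apply, hα]
    simp
    ring
  rw [hre] at h
  have hab : a = starRingEnd ℂ b :=
    sub_eq_zero.1 (norm_eq_zero.1 (pow_eq_zero_iff two_ne_zero |>.1 (le_antisymm h (sq_nonneg _))))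
  have hn : ‖a‖ = ‖b‖ := by rw [hab, RCLike.norm_conj]
  rw [ha, hb, norm_div, norm_div] at hn
  exact ((div_left_inj' (norm_ne_zero_iff.2 hx)).1 hn).symm

lemma IsUniversalSymbol.two_mul_sq_le (hF : IsUniversalSymbol.{u} F) (x d : ℝ)
    (h1 : ‖F x‖ ≤ ‖F (x - d)‖) (h2 : ‖F (x + d)‖ ≤ ‖F (x - d)‖) :
    2 * ‖F x‖ ^ 2 - ‖F (x - d)‖ ^ 2 ≤ ‖F (x + d)‖ * ‖F (x - d)‖ := by
  rcases eq_or_ne d 0 with rfl | hd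
  · simp only [sub_zero, add_zero]; nlinarith
  rcases eq_or_ne (F (x - d)) 0 with hx | hx
  · rw [hx, norm_zero] at h1 ⊢
    rw [le_antisymm h1 (norm_nonneg _)]
    simp
  set a := F x / F (x - d) with ha
  set b := F (x + d) / F (x - d) with hb
  have e0 : x - d + ((0 : Fin 3) : ℝ) * d = x - d := by simp
  have e1 : x - d + ((1 : Fin 3) : ℝ) * d = x := by simp
  have e2 : x - d + ((2 : Fin 3) : ℝ) * d = x + d := by simp; ring
  -- Rotating the circle variable by `v` makes the middle ratio real and nonnegative.
  obtain ⟨v, hv, hva⟩ : ∃ v : ℂ, ‖v‖ = 1 ∧ v * a = ‖a‖ := by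
    rcases eq_or_ne a 0 with h | h
    · exact ⟨1, by simp, by simp [h]⟩
    · refine ⟨‖a‖ / a, by simp [h], by field_simp⟩
  set r := ‖a‖
  -- Chosen so that on the circle the real part is `-2 (Re (v w) - r)²`, a nonpositive function
  -- touching zero where `Re (v w) = r`. The outcome is `2 r² - 1 ≤ Re (v² b)`.
  set q : Fin 3 → ℂ := ![-(1 + 2 * r ^ 2 : ℝ), (4 * r : ℝ) * v, -v ^ 2] with hq
  have h := hF.re_sum_div_nonpos (x := x - d) hd 0 (by rwa [e0])
    (fun i => by
      rw [e0]
      fin_cases i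
      · simp
      · simpa using h1
      · change ‖F (x - d + ((2 : Fin 3) : ℝ) * d)‖ ≤ _
        rwa [e2])
    q (fun w hw => by
      have hvw : ‖v * w‖ = 1 := by rw [norm_mul, hv, hw, one_mul]
      have : starRingEnd ℂ (w ^ ((0 : Fin 3) : ℕ)) * ∑ i : Fin 3, q i * w ^ (i : ℕ) =
          -(1 + 2 * r ^ 2 : ℝ) + (4 * r : ℝ) * (v * w) - (v * w) ^ 2 := by
        simp [Fin.sum_univ_three, hq]
        ring
      have hns : (v * w).re * (v * w).re + (v * w).im * (v * w).im = 1 := by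
        rw [← Complex.normSq_apply, ← Complex.sq_norm, hvw, one_pow]
      rw [this, sq (v * w), Complex.sub_re, Complex.add_re, Complex.re_ofReal_mul, Complex.neg_re,
        Complex.ofReal_re, Complex.mul_re (v * w)]
      nlinarith [sq_nonneg ((v * w).re - r)])
  have e : (∑ i : Fin 3, F (x - d + (i : ℝ) * d) * q i) / F (x - d) =
      -(1 + 2 * r ^ 2 : ℝ) + (4 * r * r : ℝ) - v ^ 2 * b := by
    have : ((4 * r * r : ℝ) : ℂ) = (4 * r : ℝ) * (v * a) := by rw [hva]; push_cast; ring
    rw [Fin.sum_univ_three, this]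
    simp only [Fin.val_zero, Fin.val_one, Fin.val_two] at e0 e1 e2 ⊢
    rw [e0, e1, e2, ha, hb]
    simp [hq]
    field_simp
    ring
  rw [e0, e, Complex.sub_re, Complex.add_re, Complex.neg_re, Complex.ofReal_re,
    Complex.ofReal_re] at h
  have hb' : (v ^ 2 * b).re ≤ ‖b‖ := (Complex.re_le_norm _).trans (by simp [hv])
  have hkey : 2 * r ^ 2 - 1 ≤ ‖b‖ := by nlinarith
  have hpos : 0 < ‖F (x - d)‖ := norm_pos_iff.2 hx
  have hr : ‖F x‖ = r * ‖F (x - d)‖ := by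
    rw [← norm_mul, ha, div_mul_cancel₀ _ hx]
  have hbn : ‖F (x + d)‖ = ‖b‖ * ‖F (x - d)‖ := by
    rw [← norm_mul, hb, div_mul_cancel₀ _ hx]
  rw [hr, hbn]
  nlinarith [mul_le_mul_of_nonneg_right hkey (sq_nonneg ‖F (x - d)‖)]

end ThreePoint

end UniversalSymbol

theorem theorem2p2 (F : ℝ → ℂ) (hF : UniversalSymbol.IsUniversalSymbol.{u} F) :
    IsPreconnected (UniversalSymbol.minSet F) ∧
    (UniversalSymbol.components (UniversalSymbol.minSet F)ᶜ).encard ≤ 2 ∧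
    ∀ U ∈ UniversalSymbol.components (UniversalSymbol.minSet F)ᶜ,
      (StrictMonoOn (fun x => ‖F x‖) U ∨ StrictAntiOn (fun x => ‖F x‖) U) ∧
        ¬ BddAbove ((fun x => ‖F x‖) '' U) :=
  UniversalSymbol.structure_of_three_point hF.isSymbol.continuous.norm (fun _ => norm_nonneg _)
    hF.norm_symm hF.two_mul_sq_le
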